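/- Let $n \ge 2$ and $\tau > 0$. Let $L^2_\sigma = \{v \in L^2(\mathbb{R}^n,\mathbb{R}^n) : \operatorname{div} v = 0 \text{ in the sense of distributions}\}$, with the $L^2$ norm, and let $L^\infty_t L^2_{\sigma,x} = L^\infty([0,\infty); L^2_\sigma)$. For $u^0 \in L^2_\sigma$, an admissible solution $u \in L^\infty_t L^2_{\sigma,x}$ of the Cauchy problem for the incompressible Euler equations with initial datum $u^0$ is a $u$ such that $$\int_0^\infty \int_{\mathbb{R}^n} \bigl(u \cdot \partial_t \varphi + u \otimes u : \mathrm{D}\varphi\bigr)\, dx\, dt + \int_{\mathbb{R}^n} u^0 \cdot \varphi(\cdot,0)\, dx = 0$$ for every smooth, compactly supported $\varphi \colon \mathbb{R}^n \times [0,\infty) \to \mathbb{R}^n$ that is divergence-free in $x$ (and need not vanish at $t=0$), and $$\int_{\mathbb{R}^n} |u(x,t)|^2\, dx \le \int_{\mathbb{R}^n} |u^0(x)|^2\, dx \quad \text{for almost every } t \ge 0.$$ Then the set of those $u^0 \in L^2_\sigma$ for which there exists an admissible solution $u \in L^\infty_t L^2_{\sigma,x}$ with datum $u^0$ and $\operatorname{supp}(u)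 \subset \mathbb{R}^n \times [0,\tau]$ is nowhere dense in $L^2_\sigma$. -/

import Mathlib

open MeasureTheory
open scoped ContDiff

/-- The divergence `∑ i, ∂_i v_i` at `x` of a vector field `v` on `ℝⁿ`. -/
noncomputable def fieldDiv {n : ℕ} (v : EuclideanSpace ℝ (Fin n) → EuclideanSpace ℝ (Fin n))
    (x : EuclideanSpace ℝ (Fin n)) : ℝ :=
  ∑ i : Fin n, fderiv ℝ v x (EuclideanSpace.single i 1) i

/-- `v` is a square integrable vector field on `ℝⁿ` whose distributional divergence vanishes:
`∫ v · ∇ψ = 0` for every scalar test function `ψ`. -/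
structure IsL2Sigma {n : ℕ} (v : EuclideanSpace ℝ (Fin n) → EuclideanSpace ℝ (Fin n)) : Prop where
  memLp : MemLp v 2 volume
  div_free : ∀ ψ : EuclideanSpace ℝ (Fin n) → ℝ, ContDiff ℝ ∞ ψ → HasCompactSupport ψ →
    ∫ x, inner ℝ (v x) (gradient ψ x) = 0

/-- The gradient of a test function is square integrable. -/
theorem memLp_gradient_of_test {n : ℕ} {ψ : EuclideanSpace ℝ (Fin n) → ℝ}
    (hψ : ContDiff ℝ ∞ ψ) (hc : HasCompactSupport ψ) : MemLp (gradient ψ) 2 volume := by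
  have h1 : Continuous (gradient ψ) :=
    (InnerProductSpace.toDual ℝ (EuclideanSpace ℝ (Fin n))).symm.continuous.comp
      (hψ.continuous_fderiv (by simp))
  have h2 : HasCompactSupport (gradient ψ) :=
    (hc.fderiv (𝕜 := ℝ)).comp_left
      (map_zero (InnerProductSpace.toDual ℝ (EuclideanSpace ℝ (Fin n))).symm)
  exact h1.memLp_of_hasCompactSupport h2

/-- The space `L²_σ` of square integrable divergence-free vector fields on `ℝⁿ`, with the
topology induced by the norm of `L²`. -/
noncomputable def L2Sigma (n : ℕ) :
    Submodule ℝ (Lp (EuclideanSpace ℝ (Fin n)) 2 (volume : Measure (EuclideanSpace ℝ (Fin n)))) where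
  carrier := {v | IsL2Sigma (v : EuclideanSpace ℝ (Fin n) → EuclideanSpace ℝ (Fin n))}
  zero_mem' := by
    refine ⟨Lp.memLp _, fun ψ _ _ => ?_⟩
    refine integral_eq_zero_of_ae ?_
    filter_upwards [Lp.coeFn_zero (EuclideanSpace ℝ (Fin n)) 2
      (volume : Measure (EuclideanSpace ℝ (Fin n)))] with x hx
    rw [hx, Pi.zero_apply, inner_zero_left, Pi.zero_apply]
  add_mem' := by
    intro v w hv hw
    refine ⟨Lp.memLp _, fun ψ hψ hc => ?_⟩
    have hg := memLp_gradient_of_test hψ hc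
    have hi : ∀ f : Lp (EuclideanSpace ℝ (Fin n)) 2 (volume : Measure (EuclideanSpace ℝ (Fin n))),
        Integrable (fun x => inner ℝ (f x) (gradient ψ x)) volume := by
      intro f
      refine (L2.integrable_inner (𝕜 := ℝ) f hg.toLp).congr ?_
      filter_upwards [hg.coeFn_toLp] with x hx
      rw [hx]
    have h : (fun x => inner ℝ ((v + w) x) (gradient ψ x)) =ᵐ[volume]
        fun x => inner ℝ (v x) (gradient ψ x) + inner ℝ (w x) (gradient ψ x) := by
      filter_upwards [Lp.coeFn_add v w] with x hx
      rw [hx, Pi.add_apply, inner_add_left]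
    rw [integral_congr_ae h, integral_add (hi v) (hi w), hv.div_free ψ hψ hc, hw.div_free ψ hψ hc, add_zero]
  smul_mem' := by
    intro c v hv
    refine ⟨Lp.memLp _, fun ψ hψ hc => ?_⟩
    have h : (fun x => inner ℝ ((c • v) x) (gradient ψ x)) =ᵐ[volume]
        fun x => c * inner ℝ (v x) (gradient ψ x) := by
      filter_upwards [Lp.coeFn_smul c v] with x hx
      rw [hx, Pi.smul_apply, real_inner_smul_left]
    rw [integral_congr_ae h, integral_const_mul, hv.div_free ψ hψ hc, mul_zero]

/-- Lebesgue measure on the closed space-time half space `ℝⁿ × [0, ∞)`, points being `(x, t)`. -/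
noncomputable def halfSpaceMeasure (n : ℕ) : Measure (EuclideanSpace ℝ (Fin n) × ℝ) :=
  volume.restrict (Set.univ ×ˢ Set.Ici (0 : ℝ))

/-- `u ∈ L^∞_t L²_{σ,x}` on `ℝⁿ × [0, ∞)`, with `u` given by a representative. Values of `u` at
negative times play no role. -/
structure MemLinftyL2Sigma {n : ℕ}
    (u : EuclideanSpace ℝ (Fin n) × ℝ → EuclideanSpace ℝ (Fin n)) : Prop where
  aestronglyMeasurable : AEStronglyMeasurable u (halfSpaceMeasure n)
  slice : ∀ᵐ t ∂(volume.restrict (Set.Ici (0 : ℝ))), IsL2Sigma (fun x => u (x, t))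
  bounded : ∃ C : NNReal, ∀ᵐ t ∂(volume.restrict (Set.Ici (0 : ℝ))),
    eLpNorm (fun x => u (x, t)) 2 volume ≤ C

/-- Test fields `φ ∈ C^∞_{c,σ}(ℝⁿ × [0, ∞), ℝⁿ)`, given by a smooth compactly supported extension to
`ℝⁿ × ℝ`; they need not vanish at `t = 0`, and are divergence-free in `x` at all times `t ≥ 0`. -/
structure IsSolenoidalTest {n : ℕ}
    (φ : EuclideanSpace ℝ (Fin n) × ℝ → EuclideanSpace ℝ (Fin n)) : Prop where
  smooth : ContDiff ℝ ∞ φ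
  compact_support : HasCompactSupport φ
  div_free : ∀ t : ℝ, 0 ≤ t → ∀ x, fieldDiv (fun y => φ (y, t)) x = 0

/-- `u` is a weak solution in `L^∞_t L²_{σ,x}` of the Cauchy problem for the incompressible Euler
equations with initial datum `u₀`. Here `u ⊗ u : Dφ = ∑ i j, u_i u_j ∂_j φ_i = u · (Dφ) u`. -/
structure IsWeakEulerSolution {n : ℕ}
    (u : EuclideanSpace ℝ (Fin n) × ℝ → EuclideanSpace ℝ (Fin n))
    (u₀ : EuclideanSpace ℝ (Fin n) → EuclideanSpace ℝ (Fin n)) : Prop where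
  mem : MemLinftyL2Sigma u
  weak_form : ∀ φ : EuclideanSpace ℝ (Fin n) × ℝ → EuclideanSpace ℝ (Fin n), IsSolenoidalTest φ →
    (∫ t in Set.Ici (0 : ℝ), ∫ x,
        (inner ℝ (u (x, t)) (deriv (fun s => φ (x, s)) t)
          + inner ℝ (u (x, t)) (fderiv ℝ (fun y => φ (y, t)) x (u (x, t)))))
      + ∫ x, inner ℝ (u₀ x) (φ (x, 0)) = 0

/-- `u` is an admissible solution: a weak solution satisfying the energy inequality. As `u` is only
defined up to null sets, the inequality is required at almost every time `t ≥ 0`. -/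
structure IsAdmissibleEulerSolution {n : ℕ}
    (u : EuclideanSpace ℝ (Fin n) × ℝ → EuclideanSpace ℝ (Fin n))
    (u₀ : EuclideanSpace ℝ (Fin n) → EuclideanSpace ℝ (Fin n)) : Prop where
  weak : IsWeakEulerSolution u u₀
  energy : ∀ᵐ t ∂(volume.restrict (Set.Ici (0 : ℝ))), ∫ x, ‖u (x, t)‖ ^ 2 ≤ ∫ x, ‖u₀ x‖ ^ 2

/-- The support of `u` as an a.e. class on `ℝⁿ × [0, ∞)`: the complement of the union of all open
sets on which `u` vanishes almost everywhere. -/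
def spaceTimeSupport {n : ℕ}
    (u : EuclideanSpace ℝ (Fin n) × ℝ → EuclideanSpace ℝ (Fin n)) :
    Set (EuclideanSpace ℝ (Fin n) × ℝ) :=
  (⋃₀ {U | IsOpen U ∧ ∀ᵐ p ∂(halfSpaceMeasure n), p ∈ U → u p = 0})ᶜ

open Filter Topology

/-! Extinction by time `τ` forces the datum to be small against slowly varying fields. Test the
equation with `χ(t) φ(x)`, where `φ` is solenoidal and `χ = 1` near `[0, τ]`. The time derivative
drops out, and the energy inequality gives `|⟨u₀, φ⟩| ≤ τ ‖Dφ‖_∞ ‖u₀‖²` (`abs_integral_inner_le`).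
Both sides are continuous in `u₀`, so the data obeying this for all `φ` form a closed set,
`boundedData`. It has no interior: on a ball of data the right side is uniformly `O(‖Dφ‖_∞)`, while
moving the datum along `φ` changes the left side by a multiple of `‖φ‖`. Replacing `φ` by `φ(c ·)`
with `c → 0` sends the gradient to zero without decreasing the `L²` norm, a contradiction
(`interior_boundedData`). -/

namespace EulerNowhereDense

variable {n : ℕ}

local notation "E" => EuclideanSpace ℝ (Fin n)

/-! ### Solenoidal test fields -/

/-- Smooth, compactly supported, divergence-free vector fields on `ℝⁿ`. -/
structure IsSolenoidalField (φ : E → E) : Prop where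
  smooth : ContDiff ℝ ∞ φ
  compact_support : HasCompactSupport φ
  div_free : ∀ x, fieldDiv φ x = 0

theorem IsSolenoidalField.memLp {φ : E → E} (h : IsSolenoidalField φ) : MemLp φ 2 volume :=
  h.smooth.continuous.memLp_of_hasCompactSupport h.compact_support

theorem IsSolenoidalField.exists_fderiv_bound {φ : E → E} (h : IsSolenoidalField φ) :
    ∃ M : ℝ, 0 ≤ M ∧ ∀ x, ‖fderiv ℝ φ x‖ ≤ M := by
  obtain ⟨C, hC⟩ := (h.smooth.continuous_fderiv (by simp)).bounded_above_of_compact_support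
    (h.compact_support.fderiv (𝕜 := ℝ))
  exact ⟨C, (norm_nonneg _).trans (hC 0), hC⟩

/-- Coordinatewise integration by parts. This makes test fields admissible directions in which to
perturb a datum. -/
theorem IsSolenoidalField.isL2Sigma {φ : E → E} (h : IsSolenoidalField φ) : IsL2Sigma φ := by
  refine ⟨h.memLp, fun ψ hψ hc => ?_⟩
  have hdφ : Differentiable ℝ φ := h.smooth.differentiable (by simp)
  have hdψ : Differentiable ℝ ψ := hψ.differentiable (by simp)
  have hcoord : ∀ i : Fin n, ∀ x v, fderiv ℝ (fun y => φ y i) x v = fderiv ℝ φ x v i := by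
    intro i x v
    have := ((EuclideanSpace.proj (𝕜 := ℝ) i).hasFDerivAt.comp x (hdφ x).hasFDerivAt).fderiv
    exact congrArg (fun L => L v) this
  have hφi : ∀ i : Fin n, ContDiff ℝ ∞ (fun y => φ y i) := fun i =>
    (EuclideanSpace.proj (𝕜 := ℝ) i).contDiff.comp h.smooth
  have hφic : ∀ i : Fin n, HasCompactSupport (fun y => φ y i) := fun i =>
    h.compact_support.comp_left (g := fun z : E => z i) rfl
  have hc1 : ∀ i : Fin n, Continuous (fun x => fderiv ℝ ψ x (EuclideanSpace.single i 1)) := fun i =>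
    (hψ.continuous_fderiv (by simp)).clm_apply continuous_const
  have hc2 : ∀ i : Fin n,
      Continuous (fun x => fderiv ℝ (fun y => φ y i) x (EuclideanSpace.single i 1)) := fun i =>
    ((hφi i).continuous_fderiv (by simp)).clm_apply continuous_const
  have hi1 : ∀ i : Fin n,
      Integrable (fun x => φ x i * fderiv ℝ ψ x (EuclideanSpace.single i 1)) volume := fun i =>
    ((hφi i).continuous.mul (hc1 i)).integrable_of_hasCompactSupport (hφic i).mul_right
  have hi2 : ∀ i : Fin n, Integrable
      (fun x => fderiv ℝ (fun y => φ y i) x (EuclideanSpace.single i 1) * ψ x) volume := fun i =>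
    ((hc2 i).mul hψ.continuous).integrable_of_hasCompactSupport hc.mul_left
  have hi3 : ∀ i : Fin n, Integrable (fun x => φ x i * ψ x) volume := fun i =>
    ((hφi i).continuous.mul hψ.continuous).integrable_of_hasCompactSupport hc.mul_left
  have hpt : ∀ x, inner ℝ (φ x) (gradient ψ x)
      = ∑ i : Fin n, φ x i * fderiv ℝ ψ x (EuclideanSpace.single i 1) := by
    intro x
    rw [real_inner_comm, gradient, InnerProductSpace.toDual_symm_apply]
    conv_lhs => rw [← (EuclideanSpace.basisFun (Fin n) ℝ).sum_repr (φ x)]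
    simp
  simp_rw [hpt]
  rw [integral_finsetSum _ fun i _ => hi1 i]
  have hparts : ∀ i : Fin n, ∫ x, φ x i * fderiv ℝ ψ x (EuclideanSpace.single i 1)
      = -∫ x, fderiv ℝ (fun y => φ y i) x (EuclideanSpace.single i 1) * ψ x := fun i =>
    integral_mul_fderiv_eq_neg_fderiv_mul_of_integrable (hi2 i) (hi1 i) (hi3 i)
      (fun x _ => (hφi i).differentiable (by simp) x) (fun x _ => hdψ x)
  simp_rw [hparts]
  rw [Finset.sum_neg_distrib, ← integral_finsetSum _ fun i _ => hi2 i]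
  simp_rw [← Finset.sum_mul, hcoord]
  rw [neg_eq_zero]
  refine integral_eq_zero_of_ae (Eventually.of_forall fun x => ?_)
  have := h.div_free x
  rw [fieldDiv] at this
  simp [this]

theorem fderiv_dilation (φ : E → E) (c : ℝ) (hφ : Differentiable ℝ φ) (x : E) :
    fderiv ℝ (fun y => φ (c • y)) x = c • fderiv ℝ φ (c • x) := by
  have h : HasFDerivAt (fun y : E => c • y) (c • ContinuousLinearMap.id ℝ E) x :=
    (hasFDerivAt_id x).const_smul c
  refine (HasFDerivAt.comp x (hφ (c • x)).hasFDerivAt h).fderiv.trans ?_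
  ext v
  simp

theorem IsSolenoidalField.dilation {φ : E → E} (h : IsSolenoidalField φ) {c : ℝ} (hc : c ≠ 0) :
    IsSolenoidalField (fun x => φ (c • x)) where
  smooth := h.smooth.comp (contDiff_const_smul c)
  compact_support := h.compact_support.comp_homeomorph (Homeomorph.smulOfNeZero c hc)
  div_free x := by
    have := h.div_free (c • x)
    rw [fieldDiv] at this ⊢
    simp_rw [fderiv_dilation φ c (h.smooth.differentiable (by simp))]
    simp [← Finset.mul_sum, this]

/-- A rotation field `J x` in a coordinate plane, cut off radially. `J` is trace-free, and the
gradient of the cutoff is parallel to `x`, hence orthogonal to `J x`. -/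
theorem exists_isSolenoidalField_ne_zero (hn : 2 ≤ n) :
    ∃ φ : E → E, IsSolenoidalField φ ∧ ∃ x, φ x ≠ 0 := by
  let a : Fin n := ⟨0, by omega⟩
  let b : Fin n := ⟨1, by omega⟩
  have hab : a ≠ b := by simp [a, b]
  let J : E →L[ℝ] E :=
    (EuclideanSpace.proj (𝕜 := ℝ) b).smulRight (EuclideanSpace.single a 1)
      - (EuclideanSpace.proj (𝕜 := ℝ) a).smulRight (EuclideanSpace.single b 1)
  have hJ : ∀ x : E, J x = x b • EuclideanSpace.single a 1 - x a • EuclideanSpace.single b 1 :=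
    fun x => rfl
  have hskew : ∀ x : E, inner ℝ x (J x) = 0 := by
    intro x
    rw [hJ, inner_sub_right, inner_smul_right, inner_smul_right]
    simp [EuclideanSpace.inner_single_right, mul_comm]
  -- `g` equals `1` on `(-∞, 1]` and `0` on `[2, ∞)`.
  let g : ℝ → ℝ := fun s => Real.smoothTransition (2 - s)
  have hg : ContDiff ℝ ∞ g :=
    Real.smoothTransition.contDiff.comp (contDiff_const.sub contDiff_id)
  have hgn : ContDiff ℝ ∞ (fun x : E => g (‖x‖ ^ 2)) := hg.comp (contDiff_norm_sq ℝ)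
  refine ⟨fun x => g (‖x‖ ^ 2) • J x, ⟨hgn.smul J.contDiff, ?_, ?_⟩, EuclideanSpace.single b 1, ?_⟩
  · refine HasCompactSupport.intro (isCompact_closedBall (0 : E) 2) fun x hx => ?_
    have hx2 : 2 < ‖x‖ := by simpa using hx
    have : g (‖x‖ ^ 2) = 0 := Real.smoothTransition.zero_of_nonpos (by nlinarith)
    rw [this, zero_smul]
  · intro x
    have h1 : HasFDerivAt (fun x : E => g (‖x‖ ^ 2))
        (deriv g (‖x‖ ^ 2) • (2 • (innerSL ℝ x))) x :=
      ((hg.differentiable (by simp)) _).hasDerivAt.comp_hasFDerivAt x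
        (hasStrictFDerivAt_norm_sq x).hasFDerivAt
    have h2 := (h1.smul J.hasFDerivAt).fderiv
    have h3 : ∀ i : Fin n, J (EuclideanSpace.single i 1) i = 0 := by
      intro i
      have := hskew (EuclideanSpace.single i 1)
      simpa [EuclideanSpace.inner_single_left] using this
    have h4 : ∑ i : Fin n, x i * J x i = 0 := by
      have := hskew x
      rw [PiLp.inner_apply] at this
      simpa [mul_comm] using this
    rw [fieldDiv]
    change ∑ i : Fin n, fderiv ℝ ((fun x : E => g (‖x‖ ^ 2)) • ⇑J) x _ i = 0
    rw [h2]
    have h5 : ∀ i : Fin n, (g (‖x‖ ^ 2) • J + (deriv g (‖x‖ ^ 2) • (2 • (innerSL ℝ x))).smulRight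
        (J x)) (EuclideanSpace.single i 1) i = (deriv g (‖x‖ ^ 2) * 2) * (x i * J x i) := by
      intro i
      simp [h3, EuclideanSpace.inner_single_right]
      ring
    rw [Finset.sum_congr rfl fun i _ => h5 i, ← Finset.mul_sum, h4, mul_zero]
  · have : g (‖(EuclideanSpace.single b 1 : E)‖ ^ 2) = 1 :=
      Real.smoothTransition.one_of_one_le (by simp; norm_num)
    dsimp only
    rw [this, one_smul, hJ]
    intro h
    have := congrArg (fun z : E => z a) h
    simp [hab] at this

/-! ### The bound forced by extinction -/

theorem integral_norm_sq_eq (f : Lp E 2 (volume : Measure E)) : ∫ x, ‖f x‖ ^ 2 = ‖f‖ ^ 2 := by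
  rw [← real_inner_self_eq_norm_sq, L2.inner_def]
  simp

/-- By the Lindelöf property, countably many of the open null sets already cover the complement of
the support. -/
theorem ae_eq_zero_off_spaceTimeSupport (u : E × ℝ → E) :
    ∀ᵐ p ∂(halfSpaceMeasure n), p ∉ spaceTimeSupport u → u p = 0 := by
  obtain ⟨T, hTc, hTS, hTU⟩ := TopologicalSpace.isOpen_sUnion_countable
    {U | IsOpen U ∧ ∀ᵐ p ∂(halfSpaceMeasure n), p ∈ U → u p = 0} fun U hU => hU.1
  have h := (ae_ball_iff hTc).2 fun U hU => (hTS hU).2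
  filter_upwards [h] with p hp hps
  rw [spaceTimeSupport, Set.notMem_compl_iff, ← hTU] at hps
  obtain ⟨U, hU, hpU⟩ := hps
  exact hp U hU hpU

theorem ae_slice_eq_zero {u : E × ℝ → E} {τ : ℝ}
    (h : spaceTimeSupport u ⊆ Set.univ ×ˢ Set.Icc 0 τ) :
    ∀ᵐ t ∂(volume.restrict (Set.Ici (0 : ℝ))), τ < t → ∀ᵐ x : E, u (x, t) = 0 := by
  have h0 : halfSpaceMeasure n
      = (volume : Measure E).prod (volume.restrict (Set.Ici (0 : ℝ))) := by
    rw [halfSpaceMeasure, Measure.volume_eq_prod, ← Measure.prod_restrict, Measure.restrict_univ]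
  have h1 := ae_eq_zero_off_spaceTimeSupport u
  rw [h0] at h1
  -- The factors are swapped so that Fubini puts time outermost.
  have h2 : ∀ᵐ p ∂((volume.restrict (Set.Ici (0 : ℝ))).prod (volume : Measure E)),
      p.swap ∉ spaceTimeSupport u → u p.swap = 0 :=
    Measure.measurePreserving_swap.quasiMeasurePreserving.ae h1
  filter_upwards [Measure.ae_ae_of_ae_prod h2] with t ht htτ
  filter_upwards [ht] with x hx
  exact hx fun hmem => absurd (h hmem).2.2 (not_le.2 htτ)

/-- Testing the equation with a stationary field bounds the datum in a negative norm. -/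
theorem abs_integral_inner_le {u : E × ℝ → E} {u₀ : E → E} {τ : ℝ} (hτ : 0 < τ)
    (hu : IsAdmissibleEulerSolution u u₀) (hsupp : spaceTimeSupport u ⊆ Set.univ ×ˢ Set.Icc 0 τ)
    {φ : E → E} (hφ : IsSolenoidalField φ) {M : ℝ} (hM : ∀ x, ‖fderiv ℝ φ x‖ ≤ M) :
    |∫ x, inner ℝ (u₀ x) (φ x)| ≤ τ * (M * ∫ x, ‖u₀ x‖ ^ 2) := by
  have hM0 : 0 ≤ M := (norm_nonneg _).trans (hM 0)
  -- The plateau extends beyond `τ`, so `χ' = 0` at `t = τ` too; where `χ` varies, `u` already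
  -- vanishes.
  let χ : ContDiffBump (0 : ℝ) := ⟨τ + 1, τ + 2, by linarith, by linarith⟩
  have hχ : ∀ t, 0 ≤ t → t ≤ τ → χ =ᶠ[𝓝 t] 1 := fun t h0 h1 =>
    χ.eventuallyEq_one_of_mem_ball (by
      rw [Metric.mem_ball, Real.dist_eq, sub_zero, abs_of_nonneg h0]
      change t < τ + 1
      linarith)
  have hχ1 : ∀ t, 0 ≤ t → t ≤ τ → χ t = 1 := fun t h0 h1 => (hχ t h0 h1).eq_of_nhds
  have htest : IsSolenoidalTest (fun p : E × ℝ => χ p.2 • φ p.1) := by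
    refine ⟨(χ.contDiff.comp contDiff_snd).smul (hφ.smooth.comp contDiff_fst), ?_, fun t _ x => ?_⟩
    · refine HasCompactSupport.intro (hφ.compact_support.prod χ.hasCompactSupport) fun p hp => ?_
      by_cases h1 : p.1 ∈ tsupport φ
      · have : p.2 ∉ tsupport χ := fun h2 => hp ⟨h1, h2⟩
        simp [image_eq_zero_of_notMem_tsupport this]
      · simp [image_eq_zero_of_notMem_tsupport h1]
    · have := hφ.div_free x
      rw [fieldDiv] at this ⊢
      change ∑ i, fderiv ℝ (χ t • φ) x _ i = 0
      rw [fderiv_const_smul (hφ.smooth.differentiable (by simp) x)]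
      simp [← Finset.mul_sum, this]
  have hw := hu.weak.weak_form _ htest
  simp only [hχ1 0 le_rfl hτ.le, one_smul] at hw
  rw [eq_neg_of_add_eq_zero_right hw, abs_neg, ← Real.norm_eq_abs]
  set K : ℝ := M * ∫ x, ‖u₀ x‖ ^ 2
  have hbound : ∀ᵐ t ∂(volume.restrict (Set.Ici (0 : ℝ))),
      ‖∫ x, (inner ℝ (u (x, t)) (deriv (fun s => χ s • φ x) t)
          + inner ℝ (u (x, t)) (fderiv ℝ (fun y => χ t • φ y) x (u (x, t))))‖
        ≤ (Set.Icc 0 τ).indicator (fun _ => K) t := by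
    filter_upwards [hu.energy, hu.weak.mem.slice, ae_slice_eq_zero hsupp,
      ae_restrict_mem measurableSet_Ici] with t hE hS hZ ht0
    rw [Set.mem_Ici] at ht0
    rcases le_or_gt t τ with htτ | htτ
    · rw [Set.indicator_of_mem (show t ∈ Set.Icc 0 τ from ⟨ht0, htτ⟩)]
      have hderiv : ∀ x, deriv (fun s => χ s • φ x) t = 0 := by
        intro x
        have : (fun s => χ s • φ x) =ᶠ[𝓝 t] fun _ => φ x := by
          filter_upwards [hχ t ht0 htτ] with s hs
          rw [hs, Pi.one_apply, one_smul]
        rw [this.deriv_eq, deriv_const]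
      simp only [hderiv, hχ1 t ht0 htτ, one_smul, inner_zero_right, zero_add]
      have hint : Integrable (fun x => M * ‖u (x, t)‖ ^ 2) volume :=
        ((memLp_two_iff_integrable_sq_norm hS.memLp.1).1 hS.memLp).const_mul M
      refine (norm_integral_le_of_norm_le hint (Eventually.of_forall fun x => ?_)).trans ?_
      · calc ‖inner ℝ (u (x, t)) (fderiv ℝ φ x (u (x, t)))‖
            ≤ ‖u (x, t)‖ * ‖fderiv ℝ φ x (u (x, t))‖ := norm_inner_le_norm _ _
          _ ≤ ‖u (x, t)‖ * (M * ‖u (x, t)‖) := by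
            gcongr
            exact (fderiv ℝ φ x).le_of_opNorm_le (hM x) _
          _ = M * ‖u (x, t)‖ ^ 2 := by ring
      · rw [integral_const_mul]
        exact mul_le_mul_of_nonneg_left hE hM0
    · rw [Set.indicator_of_notMem fun h => absurd h.2 (not_le.2 htτ), norm_le_zero_iff]
      refine integral_eq_zero_of_ae ?_
      filter_upwards [hZ htτ] with x hx
      simp [hx]
  have hint : Integrable ((Set.Icc 0 τ).indicator fun _ : ℝ => K)
      (volume.restrict (Set.Ici (0 : ℝ))) :=
    ((integrable_indicator_iff measurableSet_Icc).2
      (integrableOn_const (by simp))).restrict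
  refine (norm_integral_le_of_norm_le hint hbound).trans_eq ?_
  rw [integral_indicator measurableSet_Icc, Measure.restrict_restrict measurableSet_Icc,
    Set.inter_eq_left.2 fun t ht => ht.1, setIntegral_const]
  simp [hτ.le]

/-! ### A closed set of data with empty interior -/

/-- The data whose pairing with stationary test fields obeys the bound forced by extinction
before time `τ`. -/
def boundedData (n : ℕ) (τ : ℝ) : Set (L2Sigma n) :=
  {v | ∀ φ : EuclideanSpace ℝ (Fin n) → EuclideanSpace ℝ (Fin n), ∀ hφ : IsSolenoidalField φ,
    ∀ M : ℝ, (∀ x, ‖fderiv ℝ φ x‖ ≤ M) →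
      |inner ℝ (v : Lp (EuclideanSpace ℝ (Fin n)) 2 volume) hφ.memLp.toLp| ≤ τ * (M * ‖v‖ ^ 2)}

theorem isClosed_boundedData (n : ℕ) (τ : ℝ) : IsClosed (boundedData n τ) := by
  simp only [boundedData, Set.ofPred_forall]
  refine isClosed_iInter fun φ => isClosed_iInter fun hφ => isClosed_iInter fun M =>
    isClosed_iInter fun _ => isClosed_le ?_ ?_
  · exact (continuous_subtype_val.inner continuous_const).abs
  · fun_prop

/-- A solenoidal test field as an element of `L²_σ`. -/
noncomputable def IsSolenoidalField.toL2Sigma {φ : E → E} (h : IsSolenoidalField φ) : L2Sigma n :=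
  ⟨h.memLp.toLp, by
    have hae := h.memLp.coeFn_toLp
    refine ⟨Lp.memLp _, fun ψ hψ hc => ?_⟩
    rw [← h.isL2Sigma.div_free ψ hψ hc]
    refine integral_congr_ae ?_
    filter_upwards [hae] with x hx
    rw [hx]⟩

theorem norm_toL2Sigma_sq {φ : E → E} (h : IsSolenoidalField φ) :
    ‖h.toL2Sigma‖ ^ 2 = ∫ x, ‖φ x‖ ^ 2 := by
  change ‖h.memLp.toLp‖ ^ 2 = _
  rw [← integral_norm_sq_eq]
  refine integral_congr_ae ?_
  filter_upwards [h.memLp.coeFn_toLp] with x hx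
  rw [hx]

theorem norm_toL2Sigma_pos {φ : E → E} (h : IsSolenoidalField φ) {x : E} (hx : φ x ≠ 0) :
    0 < ‖h.toL2Sigma‖ := by
  have h1 : 0 < ∫ x, ‖φ x‖ ^ 2 := by
    have hcont : Continuous fun x => ‖φ x‖ ^ 2 := by
      have := h.smooth.continuous
      fun_prop
    refine hcont.integral_pos_of_hasCompactSupport_nonneg_nonzero
      (h.compact_support.comp_left (g := fun z : E => ‖z‖ ^ 2) (by simp))
      (fun x => by positivity) (x := x) (by simpa using hx)
  rw [← norm_toL2Sigma_sq h] at h1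
  exact lt_of_pow_lt_pow_left₀ 2 (norm_nonneg _) (by simpa using h1)

/-- The change of variables multiplies the squared norm by `c⁻ⁿ ≥ 1`. -/
theorem norm_toL2Sigma_le_dilation {φ : E → E} (h : IsSolenoidalField φ) {c : ℝ} (hc : 0 < c)
    (hc1 : c ≤ 1) : ‖h.toL2Sigma‖ ≤ ‖(h.dilation hc.ne').toL2Sigma‖ := by
  refine le_of_sq_le_sq ?_ (norm_nonneg _)
  rw [norm_toL2Sigma_sq, norm_toL2Sigma_sq,
    Measure.integral_comp_smul volume (fun x => ‖φ x‖ ^ 2) c, smul_eq_mul]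
  refine le_mul_of_one_le_left (integral_nonneg fun x => by positivity) ?_
  rw [abs_of_pos (by positivity)]
  exact (one_le_inv₀ (by positivity)).2 (pow_le_one₀ hc.le hc1)

theorem interior_boundedData (hn : 2 ≤ n) {τ : ℝ} (hτ : 0 < τ) :
    interior (boundedData n τ) = ∅ := by
  rw [Set.eq_empty_iff_forall_notMem]
  intro v hv
  obtain ⟨r, hr, hball⟩ := Metric.mem_nhds_iff.1 (mem_interior_iff_mem_nhds.1 hv)
  obtain ⟨φ, hφ, x₀, hx₀⟩ := exists_isSolenoidalField_ne_zero (n := n) hn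
  obtain ⟨M, hM0, hM⟩ := hφ.exists_fderiv_bound
  have hA := norm_toL2Sigma_pos hφ hx₀
  set A := ‖hφ.toL2Sigma‖
  have key : ∀ c : ℝ, 0 < c → c ≤ 1 → r / 2 * A ≤ c * (2 * (τ * (M * (‖v‖ + r) ^ 2))) := by
    intro c hc hc1
    have hφc := hφ.dilation hc.ne'
    have hAc : A ≤ ‖hφc.toL2Sigma‖ := norm_toL2Sigma_le_dilation hφ hc hc1
    set w := hφc.toL2Sigma
    have hw0 : 0 < ‖w‖ := hA.trans_le hAc
    have hMc : ∀ x, ‖fderiv ℝ (fun y => φ (c • y)) x‖ ≤ c * M := by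
      intro x
      rw [fderiv_dilation φ c (hφ.smooth.differentiable (by simp)), norm_smul, Real.norm_eq_abs,
        abs_of_pos hc]
      exact mul_le_mul_of_nonneg_left (hM _) hc.le
    have hbound : ∀ z ∈ Metric.ball v r, |inner ℝ z w| ≤ c * (τ * (M * (‖v‖ + r) ^ 2)) := by
      intro z hz
      have h1 : |inner ℝ z w| ≤ τ * (c * M * ‖z‖ ^ 2) := hball hz _ hφc _ hMc
      have h2 : ‖z‖ ≤ ‖v‖ + r := by
        have := norm_le_norm_add_norm_sub' z v
        rw [mem_ball_iff_norm] at hz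
        linarith
      calc |inner ℝ z w| ≤ τ * (c * M * ‖z‖ ^ 2) := h1
        _ ≤ τ * (c * M * (‖v‖ + r) ^ 2) := by gcongr
        _ = _ := by ring
    -- The bound at the centre `v` and at distance `r / 2` from it in direction `w` are subtracted,
    -- leaving `r / 2 * ‖w‖` and accounting for the factor `2` in `key`.
    have hb1 := hbound v (Metric.mem_ball_self hr)
    have hb2 := hbound (v + (r / 2 / ‖w‖) • w) (by
      rw [mem_ball_iff_norm, add_sub_cancel_left, norm_smul, Real.norm_eq_abs,
        abs_of_pos (by positivity), div_mul_cancel₀ _ hw0.ne']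
      linarith)
    have h5 : inner ℝ ((r / 2 / ‖w‖) • w) w = r / 2 / ‖w‖ * ‖w‖ ^ 2 := by
      rw [← real_inner_self_eq_norm_sq]
      exact real_inner_smul_left w w _
    rw [inner_add_left, h5] at hb2
    have h3 : r / 2 / ‖w‖ * ‖w‖ ^ 2 = r / 2 * ‖w‖ := by field_simp
    rw [h3] at hb2
    have h4 : r / 2 * A ≤ r / 2 * ‖w‖ := by gcongr
    have := (abs_le.1 hb1).1
    have := (abs_le.1 hb2).2
    linarith
  have hlim : Tendsto (fun c : ℝ => c * (2 * (τ * (M * (‖v‖ + r) ^ 2)))) (𝓝[>] 0) (𝓝 0) := by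
    have : Tendsto (fun c : ℝ => c * (2 * (τ * (M * (‖v‖ + r) ^ 2)))) (𝓝 0)
        (𝓝 (0 * (2 * (τ * (M * (‖v‖ + r) ^ 2))))) := tendsto_id.mul_const _
    rw [zero_mul] at this
    exact this.mono_left nhdsWithin_le_nhds
  have hle : r / 2 * A ≤ 0 := by
    refine ge_of_tendsto hlim ?_
    filter_upwards [Ioc_mem_nhdsGT (zero_lt_one' ℝ)] with c hc
    exact key c hc.1 hc.2
  have : 0 < r / 2 * A := by positivity
  linarith

end EulerNowhereDense

theorem corollaryF (n : ℕ) (hn : 2 ≤ n) (τ : ℝ) (hτ : 0 < τ) :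
    IsNowhereDense {u₀ : L2Sigma n |
      ∃ u : EuclideanSpace ℝ (Fin n) × ℝ → EuclideanSpace ℝ (Fin n),
        IsAdmissibleEulerSolution u (u₀ : Lp (EuclideanSpace ℝ (Fin n)) 2 volume) ∧
        spaceTimeSupport u ⊆ Set.univ ×ˢ Set.Icc 0 τ} := by
  refine IsNowhereDense.mono ?_ ((EulerNowhereDense.isClosed_boundedData n τ).isNowhereDense_iff.2
    (EulerNowhereDense.interior_boundedData hn hτ))
  rintro v ⟨u, hu, hsupp⟩ φ hφ M hM
  have h := EulerNowhereDense.abs_integral_inner_le hτ hu hsupp hφ hM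
  rw [EulerNowhereDense.integral_norm_sq_eq] at h
  rw [L2.inner_def]
  refine le_of_eq_of_le (congrArg _ (integral_congr_ae ?_)) h
  filter_upwards [hφ.memLp.coeFn_toLp] with x hx
  rw [hx]
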